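/- Let $(R,\mathfrak m)$ be either (a) a noetherian local ring with maximal ideal $\mathfrak m$, or (b) a standard graded algebra over a field $k$ (that is, $R=\bigoplus_{n\ge 0}R_n$ is commutative, $R_0=k$, and $R$ is generated as a $k$-algebra by the finite-dimensional space $R_1$) with graded maximal ideal $\mathfrak m=\bigoplus_{n\ge 1}R_n$. In case (b) all modules are $\mathbb Z$-graded and all maps between them are homogeneous of degree $0$. For a finitely generated $R$-module $M$ let $F$ be its minimal (in case (b): minimal graded) free resolution, filtered by the subcomplexes $(\mathcal G^nF)_i=\mathfrak m^{\,n-i}F_i$, where $\mathfrak m^j=R$ for $j\le 0$. Let $\operatorname{lin}^RF=\bigoplus_n \mathcal G^nF/\mathcal G^{n+1}F$ be the associated graded complex. The linearity defect of $M$ is $\operatorname{ld}_R M=\sup\{i: H_i(\operatorname{lin}^RF)\ne 0\}\in\mathbb N\cup\{\infty\}$, with $\operatorname{ld}_R 0=0$. The module $M$ is called Koszul if $\operatorname{ld}_RM=0$. **Theorem.** Let $0\to M'\to P'\to N'\to 0$ be a short exact sequence of non-zero finitely generated $R$-modules such that $M'$ is a Koszul module and $M'\cap\mathfrak mP'=\mathfrak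 mM'$. Then $$\operatorname{ld}_RP'\le \operatorname{ld}_RN'\le\max\{\operatorname{ld}_RP',1\}.$$ In particular, $\operatorname{ld}_RN'=\operatorname{ld}_RP'$ if $\operatorname{ld}_RP'\ge 1$, and $\operatorname{ld}_RN'\le 1$ if $\operatorname{ld}_RP'=0$. Moreover, $\operatorname{ld}_RN'=0$ if and only if $P'$ is a Koszul module and $M'\cap\mathfrak m^sP'=\mathfrak m^sM'$ for all $s\ge 1$. -/

import Mathlib

open CategoryTheory

universe u v w

/-! Minimal free resolutions, written with coordinates: `F_i = R^(rank i)`. -/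

/-- A minimal free resolution `⋯ → F₁ → F₀ → M → 0` of an `R`-module `M`, with respect to an
ideal `𝔪`, by free modules `F_i = R^(rank i)` of finite rank: the augmented complex is exact and
each differential maps `F_(i+1)` into `𝔪 F_i`. -/
structure MinimalFreeResolution {R : Type u} [CommRing R] (𝔪 : Ideal R)
    (M : Type v) [AddCommGroup M] [Module R M] where
  rank : ℕ → ℕ
  d : ∀ i, (Fin (rank (i + 1)) → R) →ₗ[R] (Fin (rank i) → R)
  aug : (Fin (rank 0) → R) →ₗ[R] M
  aug_surjective : Function.Surjective aug
  exact_zero : LinearMap.range (d 0) = LinearMap.ker aug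
  exact_succ : ∀ i, LinearMap.range (d (i + 1)) = LinearMap.ker (d i)
  minimal : ∀ i, LinearMap.range (d i) ≤ 𝔪 • (⊤ : Submodule R (Fin (rank i) → R))

namespace MinimalFreeResolution

variable {R : Type u} [CommRing R] {𝔪 : Ideal R} {M : Type v} [AddCommGroup M] [Module R M]

/-- The filtration `(𝒢ⁿF)_i = 𝔪^(n-i) F_i`, where `𝔪^j = R` for `j ≤ 0` (this is what the
truncated subtraction of natural numbers gives). -/
def filt (F : MinimalFreeResolution 𝔪 M) (n i : ℕ) : Submodule R (Fin (F.rank i) → R) :=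
  𝔪 ^ (n - i) • ⊤

lemma d_mem_filt (F : MinimalFreeResolution 𝔪 M) (n i : ℕ) :
    ∀ x ∈ F.filt n (i + 1), F.d i x ∈ F.filt n i := by
  have h : (F.filt n (i + 1)).map (F.d i) ≤ F.filt n i := by
    unfold filt
    rw [Submodule.map_smul'', Submodule.map_top]
    refine (Submodule.smul_mono le_rfl (F.minimal i)).trans ?_
    rw [← Submodule.mul_smul, ← pow_succ]
    exact Submodule.smul_mono_left (Ideal.pow_le_pow_right (by omega))
  intro x hx
  exact h (Submodule.mem_map_of_mem hx)

/-- The graded piece `(𝒢ⁿF)_i / (𝒢ⁿ⁺¹F)_i`. -/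
def Gr (F : MinimalFreeResolution 𝔪 M) (n i : ℕ) : Type u :=
  F.filt n i ⧸ (F.filt (n + 1) i).submoduleOf (F.filt n i)

instance (F : MinimalFreeResolution 𝔪 M) (n i : ℕ) : AddCommGroup (F.Gr n i) :=
  inferInstanceAs (AddCommGroup (F.filt n i ⧸ (F.filt (n + 1) i).submoduleOf (F.filt n i)))

instance (F : MinimalFreeResolution 𝔪 M) (n i : ℕ) : Module R (F.Gr n i) :=
  inferInstanceAs (Module R (F.filt n i ⧸ (F.filt (n + 1) i).submoduleOf (F.filt n i)))

/-- The map `(𝒢ⁿF)_(i+1) / (𝒢ⁿ⁺¹F)_(i+1) → (𝒢ⁿF)_i / (𝒢ⁿ⁺¹F)_i` induced by the differential. -/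
def grD (F : MinimalFreeResolution 𝔪 M) (n i : ℕ) : F.Gr n (i + 1) →ₗ[R] F.Gr n i :=
  Submodule.mapQ _ _ ((F.d i).restrict (F.d_mem_filt n i))
    (fun x hx => F.d_mem_filt (n + 1) i x.1 hx)

lemma grD_comp_grD (F : MinimalFreeResolution 𝔪 M) (n i : ℕ) :
    F.grD n i ∘ₗ F.grD n (i + 1) = 0 := by
  refine LinearMap.ext fun y => ?_
  obtain ⟨x, rfl⟩ := Submodule.Quotient.mk_surjective _ y
  have h : F.d i (F.d (i + 1) x.1) = 0 := by
    have : F.d (i + 1) x.1 ∈ LinearMap.range (F.d (i + 1)) := ⟨_, rfl⟩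
    rwa [F.exact_succ] at this
  have h' : (F.d i).restrict (F.d_mem_filt n i)
      ((F.d (i + 1)).restrict (F.d_mem_filt n (i + 1)) x) = 0 := Subtype.ext h
  exact congrArg (Submodule.Quotient.mk (p := (F.filt (n + 1) i).submoduleOf (F.filt n i))) h'

/-- The linear part of `F`: the associated graded complex `⨁ₙ 𝒢ⁿF / 𝒢ⁿ⁺¹F`. -/
noncomputable def linPart (F : MinimalFreeResolution 𝔪 M) : ChainComplex (ModuleCat.{u} R) ℕ :=
  ChainComplex.of (fun i => ModuleCat.of R (DirectSum ℕ fun n => F.Gr n i))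
    (fun i => ModuleCat.ofHom (DirectSum.lmap fun n => F.grD n i))
    (fun i => by
      rw [← ModuleCat.ofHom_comp, ← DirectSum.lmap_comp]
      have h : (fun n => F.grD n i ∘ₗ F.grD n (i + 1)) = fun n => 0 :=
        funext fun n => F.grD_comp_grD n i
      rw [h]
      ext : 1
      refine DirectSum.linearMap_ext R fun n => ?_
      ext x
      simp [DirectSum.lmap_lof])

/-- `sup {i | H_i(lin F) ≠ 0}`, with value `0` if all the homology vanishes. -/
noncomputable def linDefect (F : MinimalFreeResolution 𝔪 M) : ℕ∞ :=
  sSup {t : ℕ∞ | ∃ i : ℕ, t = i ∧ ¬ Limits.IsZero (F.linPart.homology i)}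

end MinimalFreeResolution

/-! Existence of minimal free resolutions: facts shared by the local and the graded case. -/

lemma exists_smaller_of_isUnit {R : Type u} [CommRing R] {M : Type v} [AddCommGroup M]
    [Module R M] {b : ℕ} (g : Fin (b + 1) → M) (x : Fin (b + 1) → R) (j : Fin (b + 1))
    (hj : IsUnit (x j)) (hx : ∑ l, x l • g l = 0) :
    Submodule.span R (Set.range (g ∘ j.succAbove)) = Submodule.span R (Set.range g) := by
  apply le_antisymm
  · exact Submodule.span_mono (Set.range_comp_subset_range _ _)
  · rw [Submodule.span_le]
    rintro _ ⟨l, rfl⟩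
    rcases Fin.eq_self_or_eq_succAbove j l with rfl | ⟨l', rfl⟩
    · rw [Fin.sum_univ_succAbove _ l] at hx
      obtain ⟨c, hc⟩ := hj
      have h1 : (c : R) • g l ∈ Submodule.span R (Set.range (g ∘ l.succAbove)) := by
        rw [hc, eq_neg_of_add_eq_zero_left hx]
        refine Submodule.neg_mem _ (Submodule.sum_mem _ fun i _ => Submodule.smul_mem _ _ ?_)
        exact Submodule.subset_span ⟨i, rfl⟩
      have h2 := Submodule.smul_mem _ ((c⁻¹ : Rˣ) : R) h1
      rwa [smul_smul, Units.inv_mul, one_smul] at h2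
    · exact Submodule.subset_span ⟨l', rfl⟩

lemma mem_smul_top_of_forall_mem {R : Type u} [CommRing R] {𝔪 : Ideal R} {b : ℕ}
    (x : Fin b → R) (hx : ∀ l, x l ∈ 𝔪) : x ∈ 𝔪 • (⊤ : Submodule R (Fin b → R)) := by
  have h : x = ∑ l, x l • (Pi.single l 1 : Fin b → R) := by
    ext i
    simp [Finset.sum_apply, Pi.single_apply]
  rw [h]
  exact Submodule.sum_mem _ fun l _ => Submodule.smul_mem_smul (hx l) trivial

/-- Iterating a one-step construction of minimal covers. The degrees and the conditions `Good`
and `Hom` are only used in the graded case. -/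
lemma exists_resolution_of_step {R : Type u} [CommRing R] (𝔪 : Ideal R)
    {M : Type v} [AddCommGroup M] [Module R M]
    (Good : ∀ b : ℕ, (Fin b → ℤ) → Submodule R (Fin b → R) → Prop)
    (Hom : ∀ b b' : ℕ, (Fin b' → ℤ) → (Fin b → ℤ) → ((Fin b' → R) →ₗ[R] (Fin b → R)) → Prop)
    (step : ∀ b deg K, Good b deg K → ∃ (b' : ℕ) (deg' : Fin b' → ℤ)
      (f : (Fin b' → R) →ₗ[R] (Fin b → R)), LinearMap.range f = K ∧
      (∀ x ∈ LinearMap.ker f, ∀ l, x l ∈ 𝔪) ∧ Hom b b' deg' deg f ∧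
      Good b' deg' (LinearMap.ker f))
    (b₀ : ℕ) (deg₀ : Fin b₀ → ℤ) (f₀ : (Fin b₀ → R) →ₗ[R] M)
    (hs : Function.Surjective f₀) (hm : ∀ x ∈ LinearMap.ker f₀, ∀ l, x l ∈ 𝔪)
    (hg : Good b₀ deg₀ (LinearMap.ker f₀)) :
    ∃ (F : MinimalFreeResolution 𝔪 M) (deg : ∀ i, Fin (F.rank i) → ℤ)
      (h₀ : F.rank 0 = b₀), (∀ j, deg 0 j = deg₀ (Fin.cast h₀ j)) ∧
      (∀ x, F.aug x = f₀ (fun j => x (Fin.cast h₀.symm j))) ∧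
      ∀ i, Hom _ _ (deg (i + 1)) (deg i) (F.d i) := by
  choose nb nd nf h1 h2 h3 h4 using step
  let T := Σ (b : ℕ) (deg : Fin b → ℤ),
    {K : Submodule R (Fin b → R) // Good b deg K ∧ ∀ x ∈ K, ∀ l, x l ∈ 𝔪}
  let nxt : T → T := fun t => ⟨nb t.1 t.2.1 t.2.2.1 t.2.2.2.1, nd t.1 t.2.1 t.2.2.1 t.2.2.2.1,
    LinearMap.ker (nf t.1 t.2.1 t.2.2.1 t.2.2.2.1), h4 _ _ _ _, h2 _ _ _ _⟩
  let s : ℕ → T := fun i => Nat.rec ⟨b₀, deg₀, LinearMap.ker f₀, hg, hm⟩ (fun _ t => nxt t) i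
  refine ⟨{ rank := fun i => (s i).1
            d := fun i => nf (s i).1 (s i).2.1 (s i).2.2.1 (s i).2.2.2.1
            aug := f₀
            aug_surjective := hs
            exact_zero := h1 _ _ _ _
            exact_succ := fun i => h1 _ _ _ _
            minimal := fun i => ?_ }, fun i => (s i).2.1, rfl, fun j => rfl, fun x => rfl,
            fun i => h3 _ _ _ _⟩
  rw [h1]
  intro x hx
  exact mem_smul_top_of_forall_mem x ((s i).2.2.2.2 x hx)

/-! The local case. -/

lemma IsLocalRing.exists_minimal_cover {R : Type u} [CommRing R] [IsLocalRing R]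
    {M : Type v} [AddCommGroup M] [Module R M] (K : Submodule R M) (hK : K.FG) :
    ∃ (b : ℕ) (f : (Fin b → R) →ₗ[R] M), LinearMap.range f = K ∧
      ∀ x ∈ LinearMap.ker f, ∀ l, x l ∈ IsLocalRing.maximalIdeal R := by
  classical
  have hex : ∃ b : ℕ, ∃ g : Fin b → M, Submodule.span R (Set.range g) = K :=
    Submodule.fg_iff_exists_fin_generating_family.mp hK
  obtain ⟨g, hg⟩ := Nat.find_spec hex
  have hmin := fun c (hc : c < Nat.find hex) => Nat.find_min hex hc
  generalize Nat.find hex = b at g hg hmin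
  refine ⟨b, Fintype.linearCombination R g, by rw [Fintype.range_linearCombination, hg], ?_⟩
  intro x hx l
  by_contra hl
  have hu : IsUnit (x l) := by simpa using hl
  rcases b with _ | b
  · exact l.elim0
  · refine hmin b (Nat.lt_succ_self b) ⟨g ∘ l.succAbove, ?_⟩
    rw [exists_smaller_of_isUnit g x l hu
      (by simpa [Fintype.linearCombination_apply] using hx), hg]

theorem nonempty_minimalFreeResolution (R : Type u) [CommRing R] [IsLocalRing R]
    [IsNoetherianRing R] (M : Type v) [AddCommGroup M] [Module R M] [Module.Finite R M] :
    Nonempty (MinimalFreeResolution (IsLocalRing.maximalIdeal R) M) := by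
  obtain ⟨b, f, hf, hm⟩ := IsLocalRing.exists_minimal_cover (⊤ : Submodule R M) Module.Finite.fg_top
  obtain ⟨F, -⟩ := exists_resolution_of_step (IsLocalRing.maximalIdeal R) (M := M)
    (fun _ _ _ => True) (fun _ _ _ _ _ => True)
    (fun b deg K _ => by
      obtain ⟨b', f, h1, h2⟩ := IsLocalRing.exists_minimal_cover K (IsNoetherian.noetherian K)
      exact ⟨b', fun _ => 0, f, h1, h2, trivial, trivial⟩)
    b (fun _ => 0) f (LinearMap.range_eq_top.mp hf) hm trivial
  exact ⟨F⟩

/-- The linearity defect `ld_R M` of a finitely generated module over a noetherian local ring,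
computed from the minimal free resolution of `M`. -/
noncomputable def lind (R : Type u) [CommRing R] [IsLocalRing R] [IsNoetherianRing R]
    (M : Type v) [AddCommGroup M] [Module R M] [Module.Finite R M] : ℕ∞ :=
  (Classical.choice (nonempty_minimalFreeResolution R M)).linDefect

/-- Koszul modules over a noetherian local ring. -/
def IsKoszulModule (R : Type u) [CommRing R] [IsLocalRing R] [IsNoetherianRing R]
    (M : Type v) [AddCommGroup M] [Module R M] [Module.Finite R M] : Prop :=
  lind R M = 0

/-! The graded case. -/

/-- `R = ⨁ₙ 𝒜 n` is a standard graded algebra over the field `k`: the degree zero part is `k`,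
and `R` is generated as a `k`-algebra by the finite dimensional space `𝒜 1`. -/
class IsStandardGraded {k : Type w} {R : Type u} [Field k] [CommRing R] [Algebra k R]
    (𝒜 : ℕ → Submodule k R) [GradedAlgebra 𝒜] : Prop where
  nontrivial : Nontrivial R
  degree_zero : 𝒜 0 = 1
  finite_degree_one : Module.Finite k (𝒜 1)
  adjoin_degree_one : Algebra.adjoin k (𝒜 1 : Set R) = ⊤

/-- `M = ⨁_{d ∈ ℤ} ℳ d` is a graded module over `R = ⨁ₙ 𝒜 n`. -/
class IsGradedModule {k : Type w} {R : Type u} [Field k] [CommRing R] [Algebra k R]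
    (𝒜 : ℕ → Submodule k R) {M : Type v} [AddCommGroup M] [Module R M]
    (ℳ : ℤ → AddSubgroup M) : Prop where
  isInternal : DirectSum.IsInternal ℳ
  smul_mem : ∀ (n : ℕ) (d : ℤ) (a : R) (m : M), a ∈ 𝒜 n → m ∈ ℳ d → a • m ∈ ℳ (n + d)

/-- The graded maximal ideal `⨁_{n ≥ 1} 𝒜 n`. -/
noncomputable abbrev gradedMaximalIdeal {k : Type w} {R : Type u} [Field k] [CommRing R]
    [Algebra k R] (𝒜 : ℕ → Submodule k R) [GradedAlgebra 𝒜] : Ideal R :=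
  (HomogeneousIdeal.irrelevant 𝒜).toIdeal

/-- The homogeneous part of `R` of degree `e ∈ ℤ`, which is zero for `e < 0`. -/
def degreePart {k : Type w} {R : Type u} [Field k] [CommRing R] [Algebra k R]
    (𝒜 : ℕ → Submodule k R) : ℤ → Submodule k R
  | Int.ofNat n => 𝒜 n
  | Int.negSucc _ => ⊥

/-- A minimal graded free resolution of a graded module: `F_i` is the direct sum of the shifted
modules `R(-deg i j)`, that is, its `j`-th basis vector has degree `deg i j`, and the
differentials and the augmentation are homogeneous of degree zero. -/
structure GradedMinimalFreeResolution {k : Type w} {R : Type u} [Field k] [CommRing R]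
    [Algebra k R] (𝒜 : ℕ → Submodule k R) [GradedAlgebra 𝒜] {M : Type v} [AddCommGroup M]
    [Module R M] (ℳ : ℤ → AddSubgroup M) extends
    MinimalFreeResolution (gradedMaximalIdeal 𝒜) M where
  deg : ∀ i, Fin (rank i) → ℤ
  d_homogeneous : ∀ i j l, d i (Pi.single j 1) l ∈ degreePart 𝒜 (deg (i + 1) j - deg i l)
  aug_homogeneous : ∀ j, aug (Pi.single j 1) ∈ ℳ (deg 0 j)

section GradedExistence

variable {k : Type w} {R : Type u} [Field k] [CommRing R] [Algebra k R]
  (𝒜 : ℕ → Submodule k R) [GradedAlgebra 𝒜]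

/-- Projection of `R` onto its part of degree `e ∈ ℤ`. -/
noncomputable def degreeProj : ℤ → R →+ R
  | Int.ofNat n => GradedRing.proj 𝒜 n
  | Int.negSucc _ => 0

lemma degreeProj_mem (e : ℤ) (r : R) : degreeProj 𝒜 e r ∈ degreePart 𝒜 e := by
  rcases e with n | n
  · exact SetLike.coe_mem _
  · exact Submodule.zero_mem _

lemma degreeProj_of_mem (e e' : ℤ) (r : R) (hr : r ∈ degreePart 𝒜 e') :
    degreeProj 𝒜 e r = if e = e' then r else 0 := by
  rcases e' with n' | n'
  · rcases e with n | n
    · change ((DirectSum.decompose 𝒜 r n : 𝒜 n) : R) = _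
      split_ifs with h
      · have h' : n = n' := by simpa using h
        subst h'
        exact DirectSum.decompose_of_mem_same 𝒜 hr
      · exact DirectSum.decompose_of_mem_ne 𝒜 hr (fun h' => h (by rw [h']))
    · simp [degreeProj]
  · have h0 : r = 0 := by simpa [degreePart] using hr
    simp [h0]

lemma sum_degreeProj (r : R) : ∃ N : ℕ, ∀ N' ≥ N,
    r = ∑ n ∈ Finset.range N', degreeProj 𝒜 (n : ℤ) r := by
  classical
  refine ⟨(DirectSum.decompose 𝒜 r).support.sup id + 1, fun N' hN' => ?_⟩
  conv_lhs => rw [← DirectSum.sum_support_decompose 𝒜 r]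
  refine Finset.sum_subset (fun n hn => ?_) (fun n _ hn => ?_)
  · have : n ≤ (DirectSum.decompose 𝒜 r).support.sup id := Finset.le_sup (f := id) hn
    simp only [Finset.mem_range]
    omega
  · simpa using hn

/-- The degree `d` part of the free module with basis in degrees `deg`. -/
def freePart {b : ℕ} (deg : Fin b → ℤ) (d : ℤ) : AddSubgroup (Fin b → R) where
  carrier := {x | ∀ l, x l ∈ degreePart 𝒜 (d - deg l)}
  add_mem' := fun hx hy l => Submodule.add_mem _ (hx l) (hy l)
  zero_mem' := fun _ => Submodule.zero_mem _
  neg_mem' := fun hx l => Submodule.neg_mem _ (hx l)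

/-- Projection onto the degree `d` part of a graded free module. -/
noncomputable def freeProj {b : ℕ} (deg : Fin b → ℤ) (d : ℤ) : (Fin b → R) →+ (Fin b → R) where
  toFun := fun x l => degreeProj 𝒜 (d - deg l) (x l)
  map_zero' := by ext; simp
  map_add' := fun x y => by ext; simp

lemma exists_graded_cover [IsStandardGraded 𝒜] {M : Type v} [AddCommGroup M] [Module R M]
    (𝒢 : ℤ → AddSubgroup M) (π : ℤ → M →+ M)
    (hπ : ∀ d e m, m ∈ 𝒢 e → π d m = if d = e then m else 0)
    (hsmul : ∀ (n : ℕ) (d : ℤ) (a : R) (m : M), a ∈ 𝒜 n → m ∈ 𝒢 d → a • m ∈ 𝒢 (n + d))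
    (K : Submodule R M) (hK : K.FG)
    (hKh : Submodule.span R {m | m ∈ K ∧ ∃ d, m ∈ 𝒢 d} = K) :
    ∃ (b : ℕ) (deg : Fin b → ℤ) (f : (Fin b → R) →ₗ[R] M), LinearMap.range f = K ∧
      (∀ x ∈ LinearMap.ker f, ∀ l, x l ∈ gradedMaximalIdeal 𝒜) ∧
      (∀ j, f (Pi.single j 1) ∈ 𝒢 (deg j)) ∧
      Submodule.span R {x | x ∈ LinearMap.ker f ∧ ∃ d, x ∈ freePart 𝒜 deg d} =
        LinearMap.ker f := by
  classical
  have hex : ∃ b : ℕ, ∃ (g : Fin b → M), (∀ j, ∃ d, g j ∈ 𝒢 d) ∧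
      Submodule.span R (Set.range g) = K := by
    rw [← hKh] at hK
    obtain ⟨t, ht, hts⟩ := (Submodule.fg_span_iff_fg_span_finset_subset _).mp hK
    refine ⟨t.card, fun j => (t.equivFin.symm j : M), fun j => ?_, ?_⟩
    · exact (ht (t.equivFin.symm j).2).2
    · have : Set.range (fun j => (t.equivFin.symm j : M)) = (t : Set M) := by
        ext m
        constructor
        · rintro ⟨j, rfl⟩
          exact (t.equivFin.symm j).2
        · intro hm
          exact ⟨t.equivFin ⟨m, hm⟩, by simp⟩
      rw [this, ← hts, hKh]
  obtain ⟨g, hgd, hg⟩ := Nat.find_spec hex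
  have hmin := fun c (hc : c < Nat.find hex) => Nat.find_min hex hc
  generalize Nat.find hex = b at g hgd hg hmin
  choose deg hdeg using hgd
  have hterm : ∀ (d : ℤ) (l : Fin b) (r : R),
      π d (r • g l) = degreeProj 𝒜 (d - deg l) r • g l := by
    intro d l r
    obtain ⟨N, hN⟩ := sum_degreeProj 𝒜 r
    have hr := hN N le_rfl
    have hpiece : ∀ n : ℕ, π d (degreeProj 𝒜 (n : ℤ) r • g l) =
        if d = n + deg l then degreeProj 𝒜 (n : ℤ) r • g l else 0 := fun n =>
      hπ d _ _ (hsmul n (deg l) _ _ (degreeProj_mem 𝒜 (n : ℤ) r) (hdeg l))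
    have hL : π d (r • g l) = ∑ n ∈ Finset.range N,
        if d = n + deg l then degreeProj 𝒜 (n : ℤ) r • g l else 0 := by
      conv_lhs => rw [hr, Finset.sum_smul, map_sum]
      exact Finset.sum_congr rfl fun n _ => hpiece n
    have hR : degreeProj 𝒜 (d - deg l) r • g l = ∑ n ∈ Finset.range N,
        if d = n + deg l then degreeProj 𝒜 (n : ℤ) r • g l else 0 := by
      conv_lhs => rw [hr, map_sum, Finset.sum_smul]
      refine Finset.sum_congr rfl fun n _ => ?_
      rw [degreeProj_of_mem 𝒜 _ _ _ (degreeProj_mem 𝒜 (n : ℤ) r)]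
      by_cases h : d = n + deg l
      · rw [if_pos h, if_pos (by omega)]
      · rw [if_neg h, if_neg (by omega), zero_smul]
    rw [hL, hR]
  have hproj : ∀ (d : ℤ) (x : Fin b → R),
      π d (Fintype.linearCombination R g x) =
        Fintype.linearCombination R g (freeProj 𝒜 deg d x) := by
    intro d x
    simp only [Fintype.linearCombination_apply, map_sum, hterm]
    rfl
  have hker : ∀ (d : ℤ) (x : Fin b → R), x ∈ LinearMap.ker (Fintype.linearCombination R g) →
      freeProj 𝒜 deg d x ∈ LinearMap.ker (Fintype.linearCombination R g) := by
    intro d x hx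
    rw [LinearMap.mem_ker] at hx ⊢
    rw [← hproj, hx, map_zero]
  refine ⟨b, deg, Fintype.linearCombination R g,
    by rw [Fintype.range_linearCombination, hg], ?_, ?_, ?_⟩
  · intro x hx l
    by_contra hl
    have hu : IsUnit (freeProj 𝒜 deg (deg l) x l) := by
      have h0 : freeProj 𝒜 deg (deg l) x l = GradedRing.proj 𝒜 0 (x l) := by
        change degreeProj 𝒜 (deg l - deg l) (x l) = _
        rw [sub_self]
        rfl
      have hne : GradedRing.proj 𝒜 0 (x l) ≠ 0 := by
        rwa [HomogeneousIdeal.mem_iff, HomogeneousIdeal.mem_irrelevant_iff] at hl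
      have hmem : GradedRing.proj 𝒜 0 (x l) ∈ 𝒜 0 := SetLike.coe_mem _
      rw [IsStandardGraded.degree_zero (𝒜 := 𝒜), Submodule.mem_one] at hmem
      obtain ⟨c, hc⟩ := hmem
      rw [h0, ← hc]
      refine (IsUnit.mk0 c ?_).map (algebraMap k R)
      rintro rfl
      exact hne (by rw [← hc, map_zero])
    rcases b with _ | b
    · exact l.elim0
    · refine hmin b (Nat.lt_succ_self b) ⟨g ∘ l.succAbove, fun j => ⟨_, hdeg _⟩, ?_⟩
      rw [exists_smaller_of_isUnit g _ l hu
        (by simpa [Fintype.linearCombination_apply] using hker (deg l) x hx), hg]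
  · intro j
    rw [Fintype.linearCombination_apply_single, one_smul]
    exact hdeg j
  · apply le_antisymm
    · rw [Submodule.span_le]
      exact fun x hx => hx.1
    · intro x hx
      choose N hN using fun l => sum_degreeProj 𝒜 (x l)
      obtain ⟨B, hB⟩ : ∃ B : ℕ, ∀ l, N l ≤ B ∧ (deg l).natAbs ≤ B := by
        refine ⟨∑ l, (N l + (deg l).natAbs), fun l => ?_⟩
        have := Finset.single_le_sum (f := fun l => N l + (deg l).natAbs)
          (fun _ _ => Nat.zero_le _) (Finset.mem_univ l)
        have h2 : N l + (deg l).natAbs ≤ ∑ l, (N l + (deg l).natAbs) := this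
        omega
      have hsum : x = ∑ d ∈ Finset.Ico (-(B : ℤ)) (2 * B), freeProj 𝒜 deg d x := by
        ext l
        rw [Finset.sum_apply]
        have hd := hB l
        change x l = ∑ d ∈ Finset.Ico (-(B : ℤ)) (2 * B), degreeProj 𝒜 (d - deg l) (x l)
        have h1 := hN l ((2 * B - deg l).toNat) (by omega)
        conv_lhs => rw [h1]
        refine Finset.sum_bij_ne_zero (fun n _ _ => (n : ℤ) + deg l) ?_ ?_ ?_ ?_
        · intro n hn _
          simp only [Finset.mem_range, Finset.mem_Ico] at hn ⊢
          omega
        · intro a _ _ c _ _ h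
          omega
        · intro d hd' hne
          have hnn : 0 ≤ d - deg l := by
            by_contra hneg
            obtain ⟨m, hm⟩ := Int.eq_negSucc_of_lt_zero (not_le.mp hneg)
            rw [hm] at hne
            exact hne rfl
          refine ⟨(d - deg l).toNat, ?_, ?_, ?_⟩
          · simp only [Finset.mem_range, Finset.mem_Ico] at hd' ⊢
            omega
          · rwa [Int.toNat_of_nonneg hnn]
          · rw [Int.toNat_of_nonneg hnn]
            ring
        · intro n _ _
          rw [add_sub_cancel_right]
      rw [hsum]
      refine Submodule.sum_mem _ fun d _ => Submodule.subset_span ⟨hker d x hx, d, fun l => ?_⟩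
      exact degreeProj_mem 𝒜 _ _

lemma freePart_smul_mem {b : ℕ} (deg : Fin b → ℤ) (n : ℕ) (d : ℤ) (a : R) (m : Fin b → R)
    (ha : a ∈ 𝒜 n) (hm : m ∈ freePart 𝒜 deg d) : a • m ∈ freePart 𝒜 deg (n + d) := by
  intro l
  have h := hm l
  rw [add_sub_assoc]
  rcases h' : d - deg l with e | e
  · rw [h'] at h
    exact SetLike.GradedMul.mul_mem (A := 𝒜) ha h
  · rw [h'] at h
    have h0 : m l = 0 := h
    simp [h0]

theorem IsStandardGraded.isNoetherianRing [h : IsStandardGraded 𝒜] : IsNoetherianRing R := by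
  have hf := h.finite_degree_one
  obtain ⟨t, ht⟩ := (Module.Finite.iff_fg.mp hf)
  have : Algebra.FiniteType k R := ⟨⟨t, by
    rw [← h.adjoin_degree_one, ← ht, Algebra.adjoin_span]⟩⟩
  exact Algebra.FiniteType.isNoetherianRing k R

theorem nonempty_gradedMinimalFreeResolution [IsStandardGraded 𝒜] {M : Type v}
    [AddCommGroup M] [Module R M] [Module.Finite R M] (ℳ : ℤ → AddSubgroup M)
    [hℳ : IsGradedModule 𝒜 ℳ] : Nonempty (GradedMinimalFreeResolution 𝒜 ℳ) := by
  classical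
  have := IsStandardGraded.isNoetherianRing 𝒜
  let _ : DirectSum.Decomposition ℳ := hℳ.isInternal.chooseDecomposition
  let π : ℤ → M →+ M := fun d =>
    { toFun := fun m => (DirectSum.decompose ℳ m d : M)
      map_zero' := by simp
      map_add' := fun x y => by simp }
  have hπ : ∀ d e m, m ∈ ℳ e → π d m = if d = e then m else 0 := by
    intro d e m hm
    change (DirectSum.decompose ℳ m d : M) = _
    split_ifs with h
    · subst h
      exact DirectSum.decompose_of_mem_same ℳ hm
    · exact DirectSum.decompose_of_mem_ne ℳ hm (Ne.symm h)
  have htop : Submodule.span R {m | m ∈ (⊤ : Submodule R M) ∧ ∃ d, m ∈ ℳ d} = ⊤ := by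
    rw [eq_top_iff]
    intro m _
    rw [← DirectSum.sum_support_decompose ℳ m]
    exact Submodule.sum_mem _ fun d _ =>
      Submodule.subset_span ⟨trivial, d, SetLike.coe_mem _⟩
  obtain ⟨b, deg, f, hr, hm, hh, hk⟩ :=
    exists_graded_cover 𝒜 ℳ π hπ hℳ.smul_mem ⊤ Module.Finite.fg_top htop
  obtain ⟨F, dg, h₀, hd0, haug, hhom⟩ := exists_resolution_of_step (gradedMaximalIdeal 𝒜) (M := M)
    (fun b deg K => Submodule.span R {x | x ∈ K ∧ ∃ d, x ∈ freePart 𝒜 deg d} = K)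
    (fun b b' deg' deg f => ∀ j, f (Pi.single j 1) ∈ freePart 𝒜 deg (deg' j))
    (fun b deg K hK => exists_graded_cover 𝒜 (freePart 𝒜 deg) (freeProj 𝒜 deg)
      (fun d e m hm => by
        ext l
        change degreeProj 𝒜 (d - deg l) (m l) = _
        rw [degreeProj_of_mem 𝒜 _ _ _ (hm l)]
        by_cases h : d = e
        · simp [h]
        · rw [if_neg h, if_neg (by omega)]
          rfl)
      (freePart_smul_mem 𝒜 deg) K (IsNoetherian.noetherian K) hK)
    b deg f (LinearMap.range_eq_top.mp hr) hm hk
  refine ⟨{ F with deg := dg, d_homogeneous := fun i j l => hhom i j l, aug_homogeneous := ?_ }⟩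
  intro j
  rw [haug, hd0]
  have : (fun i => (Pi.single j 1 : Fin (F.rank 0) → R) (Fin.cast h₀.symm i)) =
      Pi.single (Fin.cast h₀ j) 1 := by
    ext i
    simp only [Pi.single_apply, Fin.ext_iff, Fin.val_cast]
  rw [this]
  exact hh _

end GradedExistence

/-- The linearity defect of a finitely generated graded module over a standard graded algebra,
computed from the minimal graded free resolution of `M`. -/
noncomputable def gradedLind {k : Type w} {R : Type u} [Field k] [CommRing R] [Algebra k R]
    (𝒜 : ℕ → Submodule k R) [GradedAlgebra 𝒜] [IsStandardGraded 𝒜] {M : Type v}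
    [AddCommGroup M] [Module R M] [Module.Finite R M] (ℳ : ℤ → AddSubgroup M)
    [IsGradedModule 𝒜 ℳ] : ℕ∞ :=
  (Classical.choice (nonempty_gradedMinimalFreeResolution 𝒜 ℳ)).linDefect

/-- Graded Koszul modules over a standard graded algebra. -/
def IsGradedKoszulModule {k : Type w} {R : Type u} [Field k] [CommRing R] [Algebra k R]
    (𝒜 : ℕ → Submodule k R) [GradedAlgebra 𝒜] [IsStandardGraded 𝒜] {M : Type v}
    [AddCommGroup M] [Module R M] [Module.Finite R M] (ℳ : ℤ → AddSubgroup M)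
    [IsGradedModule 𝒜 ℳ] : Prop :=
  gradedLind 𝒜 ℳ = 0

/-! The associated graded complex of a filtered exact complex is exact in all degrees above `e` if
and only if the differentials `d_i` with `i ≥ e` are strict for the filtration. For the filtration
`𝔪^(n-i) F_i`, strictness says that every boundary in `𝔪^(n+1) F_i` is the image of an element of
`𝔪^n F_(i+1)`: a condition on the single map `d_i`, which makes sense for any resolution by
projective modules and is invariant under homotopy equivalence.

The minimal resolutions of `M'` and `N'` are glued to a resolution of `P'`, with differential
`(u, v) ↦ (d u + τ v, d v)`. As `M'` is Koszul and `M' ∩ 𝔪P' = 𝔪M'`, the twist `τ` takes values in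
`𝔪 F`. Strictness can then be chased between the glued differential and the differential of the
resolution of `N'`. In degree zero, where the augmentations enter, it has to be supplemented by
`M' ∩ 𝔪^s P' = 𝔪^s M'`. -/

section IdealPowers

variable {R : Type*} [CommRing R] {I : Ideal R} {A B : Type*} [AddCommGroup A] [Module R A]
  [AddCommGroup B] [Module R B] {f : A →ₗ[R] B}

lemma pow_succ_smul_top_le (I : Ideal R) (A : Type*) [AddCommGroup A] [Module R A] (n : ℕ) :
    I ^ (n + 1) • (⊤ : Submodule R A) ≤ I ^ n • ⊤ :=
  Submodule.smul_mono_left (Ideal.pow_le_pow_right n.le_succ)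

lemma map_mem_pow_succ_smul_top (hf : LinearMap.range f ≤ I • (⊤ : Submodule R B)) {n : ℕ} {x : A}
    (hx : x ∈ I ^ n • (⊤ : Submodule R A)) : f x ∈ I ^ (n + 1) • (⊤ : Submodule R B) := by
  have h : (I ^ n • (⊤ : Submodule R A)).map f ≤ I ^ (n + 1) • ⊤ := by
    rw [Submodule.map_smul'', Submodule.map_top, pow_succ, Submodule.mul_smul]
    exact Submodule.smul_mono le_rfl hf
  exact h (Submodule.mem_map_of_mem hx)

lemma exists_mem_smul_top_of_surjective (hf : Function.Surjective f) {y : B}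
    (hy : y ∈ I • (⊤ : Submodule R B)) : ∃ x ∈ I • (⊤ : Submodule R A), f x = y := by
  rwa [← LinearMap.range_eq_top.mpr hf, ← Submodule.map_top, ← Submodule.map_smul''] at hy

lemma prodMk_mem_smul_top {a : A} {b : B} (ha : a ∈ I • (⊤ : Submodule R A))
    (hb : b ∈ I • (⊤ : Submodule R B)) : (a, b) ∈ I • (⊤ : Submodule R (A × B)) := by
  have ha' : (a, (0 : B)) ∈ I • (⊤ : Submodule R (A × B)) :=
    Submodule.smul_top_le_comap_smul_top I (LinearMap.inl R A B) ha
  have hb' : ((0 : A), b) ∈ I • (⊤ : Submodule R (A × B)) :=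
    Submodule.smul_top_le_comap_smul_top I (LinearMap.inr R A B) hb
  simpa using Submodule.add_mem _ ha' hb'

lemma range_inf_smul_top_eq_map_iff (hf : Function.Injective f) :
    LinearMap.range f ⊓ I • (⊤ : Submodule R B) = (I • (⊤ : Submodule R A)).map f ↔
      (I • (⊤ : Submodule R B)).comap f ≤ I • ⊤ := by
  rw [← Submodule.map_comap_eq, (Submodule.map_injective_of_injective hf).eq_iff]
  exact (Submodule.smul_top_le_comap_smul_top I f).ge_iff_eq'.symm

end IdealPowers

section ShiftStrict

variable {R : Type*} [CommRing R] {I : Ideal R}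
  {A B A' B' : Type*} [AddCommGroup A] [Module R A] [AddCommGroup B] [Module R B]
  [AddCommGroup A'] [Module R A'] [AddCommGroup B'] [Module R B']

/-- Strictness of a linear map for the `I`-adic filtrations, that of the target being shifted by
one: this is strictness of `d_i : F_(i+1) → F_i` for the filtration `𝔪^(n-i) F_i` of a minimal
resolution. -/
def IsShiftStrict (I : Ideal R) (f : A →ₗ[R] B) : Prop :=
  ∀ (n : ℕ) (x : A), f x ∈ I ^ (n + 1) • (⊤ : Submodule R B) →
    ∃ x' ∈ I ^ n • (⊤ : Submodule R A), f x' = f x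

/-- The map `f`, viewed as a piece of a complex, is a homotopy retract of the map `f'`: there are
morphisms of arrows `f → f' → f` whose composite on the target agrees with the identity on the
range of `f` up to a homotopy `h`. -/
def IsHomotopyRetract (f : A →ₗ[R] B) (f' : A' →ₗ[R] B') : Prop :=
  ∃ (a₁ : A →ₗ[R] A') (a₀ : B →ₗ[R] B') (b₁ : A' →ₗ[R] A) (b₀ : B' →ₗ[R] B) (h : B →ₗ[R] A),
    (∀ x, f' (a₁ x) = a₀ (f x)) ∧ (∀ x, f (b₁ x) = b₀ (f' x)) ∧
      ∀ x, f x = b₀ (a₀ (f x)) + f (h (f x))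

lemma IsHomotopyRetract.isShiftStrict {f : A →ₗ[R] B} {f' : A' →ₗ[R] B'}
    (hff' : IsHomotopyRetract f f') (hf' : IsShiftStrict I f') : IsShiftStrict I f := by
  obtain ⟨a₁, a₀, b₁, b₀, h, ha, hb, hh⟩ := hff'
  intro n x hx
  obtain ⟨y, hy, hyx⟩ := hf' n (a₁ x) (by
    rw [ha]
    exact Submodule.smul_top_le_comap_smul_top _ a₀ hx)
  have hfx : h (f x) ∈ I ^ n • (⊤ : Submodule R A) :=
    pow_succ_smul_top_le I A n (Submodule.smul_top_le_comap_smul_top _ h hx)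
  refine ⟨b₁ y + h (f x),
    Submodule.add_mem _ (Submodule.smul_top_le_comap_smul_top _ b₁ hy) hfx, ?_⟩
  rw [map_add, hb, hyx, ha, ← hh]

end ShiftStrict

section Comparison

variable {R : Type*} [CommRing R]

lemma exists_comp_eq_of_range_le {A B C : Type*} [AddCommGroup A] [Module R A]
    [Module.Projective R A] [AddCommGroup B] [Module R B] [AddCommGroup C] [Module R C]
    (f : A →ₗ[R] C) (g : B →ₗ[R] C) (h : LinearMap.range f ≤ LinearMap.range g) :
    ∃ l : A →ₗ[R] B, g ∘ₗ l = f := by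
  obtain ⟨l, hl⟩ := Module.projective_lifting_property g.rangeRestrict
    (f.codRestrict (LinearMap.range g) fun x => h ⟨x, rfl⟩) g.surjective_rangeRestrict
  exact ⟨l, LinearMap.ext fun x => congrArg Subtype.val (LinearMap.congr_fun hl x)⟩

lemma exists_comp_eq_of_exact {A B C D : Type*} [AddCommGroup A] [Module R A]
    [Module.Projective R A] [AddCommGroup B] [Module R B] [AddCommGroup C] [Module R C]
    [AddCommGroup D] [Module R D] {g : B →ₗ[R] C} {k : C →ₗ[R] D} (hgk : Function.Exact g k)
    (f : A →ₗ[R] C) (hf : ∀ x, k (f x) = 0) : ∃ l : A →ₗ[R] B, ∀ x, g (l x) = f x := by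
  obtain ⟨l, hl⟩ := exists_comp_eq_of_range_le f g (by
    rintro _ ⟨x, rfl⟩
    exact (hgk _).mp (hf x))
  exact ⟨l, LinearMap.congr_fun hl⟩

lemma IsHomotopyRetract.of_exact {A B C A' B' C' : Type*}
    [AddCommGroup A] [Module R A] [Module.Projective R A]
    [AddCommGroup B] [Module R B] [Module.Projective R B] [AddCommGroup C] [Module R C]
    [AddCommGroup A'] [Module R A'] [Module.Projective R A']
    [AddCommGroup B'] [Module R B'] [AddCommGroup C'] [Module R C']
    {f : A →ₗ[R] B} {g : B →ₗ[R] C} {f' : A' →ₗ[R] B'} {g' : B' →ₗ[R] C'}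
    (hfg : Function.Exact f g) (hfg' : Function.Exact f' g') (hgg' : IsHomotopyRetract g g') :
    IsHomotopyRetract f f' := by
  obtain ⟨a₁, a₀, b₁, b₀, h, ha, hb, hh⟩ := hgg'
  obtain ⟨a₂, ha₂⟩ := exists_comp_eq_of_exact hfg' (a₁ ∘ₗ f) fun x => by
    rw [LinearMap.comp_apply, ha, hfg.apply_apply_eq_zero, map_zero]
  obtain ⟨b₂, hb₂⟩ := exists_comp_eq_of_exact hfg (b₁ ∘ₗ f') fun x => by
    rw [LinearMap.comp_apply, hb, hfg'.apply_apply_eq_zero, map_zero]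
  obtain ⟨k, hk⟩ := exists_comp_eq_of_exact hfg (LinearMap.id - b₁ ∘ₗ a₁ - h ∘ₗ g) fun x => by
    simp only [LinearMap.sub_apply, LinearMap.id_apply, LinearMap.comp_apply, map_sub, hb, ha]
    rw [sub_sub, ← hh, sub_self]
  refine ⟨a₂, a₁, b₂, b₁, k, ha₂, hb₂, fun x => ?_⟩
  rw [hk]
  simp [hfg.apply_apply_eq_zero]

variable {M : Type*} [AddCommGroup M] [Module R M]
  {X Y : ℕ → Type*} [∀ i, AddCommGroup (X i)] [∀ i, Module R (X i)]
  [∀ i, AddCommGroup (Y i)] [∀ i, Module R (Y i)]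

/-- The sequence `⋯ → X 1 → X 0 → M → 0` is exact. The modules `X i` may be arbitrary, so that the
notion also covers a resolution glued from two minimal free resolutions. -/
structure IsResolution (d : ∀ i, X (i + 1) →ₗ[R] X i) (ε : X 0 →ₗ[R] M) : Prop where
  surjective : Function.Surjective ε
  exact_zero : Function.Exact (d 0) ε
  exact_succ : ∀ i, Function.Exact (d (i + 1)) (d i)

namespace IsResolution

variable [∀ i, Module.Projective R (X i)] [∀ i, Module.Projective R (Y i)]
  {dX : ∀ i, X (i + 1) →ₗ[R] X i} {dY : ∀ i, Y (i + 1) →ₗ[R] Y i}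
  {εX : X 0 →ₗ[R] M} {εY : Y 0 →ₗ[R] M}

lemma isHomotopyRetract (hX : IsResolution dX εX) (hY : IsResolution dY εY) (i : ℕ) :
    IsHomotopyRetract (dX i) (dY i) := by
  induction i with
  | zero =>
    obtain ⟨a, ha⟩ := Module.projective_lifting_property εY εX hY.surjective
    obtain ⟨b, hb⟩ := Module.projective_lifting_property εX εY hX.surjective
    have hε : IsHomotopyRetract εX εY := ⟨a, LinearMap.id, b, LinearMap.id, 0,
      LinearMap.congr_fun ha, LinearMap.congr_fun hb, fun x => by simp⟩
    exact hε.of_exact hX.exact_zero hY.exact_zero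
  | succ i ih => exact ih.of_exact (hX.exact_succ i) (hY.exact_succ i)

lemma isShiftStrict_iff {I : Ideal R} (hX : IsResolution dX εX) (hY : IsResolution dY εY) (i : ℕ) :
    IsShiftStrict I (dX i) ↔ IsShiftStrict I (dY i) :=
  ⟨(hY.isHomotopyRetract hX i).isShiftStrict, (hX.isHomotopyRetract hY i).isShiftStrict⟩

end IsResolution

end Comparison

lemma exact_lmap_iff {R ι : Type*} [CommRing R] {A B C : ι → Type*}
    [∀ i, AddCommGroup (A i)] [∀ i, Module R (A i)] [∀ i, AddCommGroup (B i)]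
    [∀ i, Module R (B i)] [∀ i, AddCommGroup (C i)] [∀ i, Module R (C i)]
    (f : ∀ i, A i →ₗ[R] B i) (g : ∀ i, B i →ₗ[R] C i) :
    Function.Exact (DirectSum.lmap f) (DirectSum.lmap g) ↔ ∀ i, Function.Exact (f i) (g i) := by
  classical
  constructor
  · intro h i x
    have hx := h (DirectSum.lof R ι B i x)
    rw [DirectSum.lmap_lof] at hx
    constructor
    · intro hgx
      obtain ⟨y, hy⟩ := hx.mp (by rw [hgx, map_zero])
      refine ⟨y i, ?_⟩
      rw [← DirectSum.lmap_apply, hy, DirectSum.lof_apply]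
    · rintro ⟨y, rfl⟩
      have hy := hx.mpr ⟨DirectSum.lof R ι A i y, DirectSum.lmap_lof _ _ _⟩
      rw [← DirectSum.lof_apply R (M := C) i (g i (f i y)), hy, DirectSum.zero_apply]
  · intro h
    simp only [LinearMap.exact_iff] at h ⊢
    simp only [DirectSum.ker_lmap, DirectSum.range_lmap, h]

namespace MinimalFreeResolution

variable {R : Type u} [CommRing R] {𝔪 : Ideal R} {M : Type v} [AddCommGroup M] [Module R M]
  (F : MinimalFreeResolution 𝔪 M)

lemma isResolution : IsResolution (X := fun i => Fin (F.rank i) → R) F.d F.aug where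
  surjective := F.aug_surjective
  exact_zero := LinearMap.exact_iff.mpr F.exact_zero.symm
  exact_succ i := LinearMap.exact_iff.mpr (F.exact_succ i).symm

lemma filt_of_le {n i : ℕ} (h : n ≤ i) : F.filt n i = ⊤ := by
  rw [filt, Nat.sub_eq_zero_of_le h, pow_zero, Ideal.one_eq_top, Submodule.top_smul]

lemma filt_succ_le (n i : ℕ) : F.filt (n + 1) i ≤ F.filt n i :=
  Submodule.smul_mono_left (Ideal.pow_le_pow_right (by omega))

lemma isZero_homology_linPart_iff (i : ℕ) :
    Limits.IsZero (F.linPart.homology (i + 1)) ↔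
      ∀ n, Function.Exact (F.grD n (i + 1)) (F.grD n i) := by
  have hd (j : ℕ) : (F.linPart.d (j + 1) j).hom = DirectSum.lmap fun n => F.grD n j := by
    simp only [linPart, ChainComplex.of_d, ModuleCat.hom_ofHom]
    rfl
  rw [← HomologicalComplex.exactAt_iff_isZero_homology,
    HomologicalComplex.exactAt_iff' _ (i + 2) (i + 1) i (by simp) (by simp),
    ShortComplex.moduleCat_exact_iff_range_eq_ker, eq_comm, ← LinearMap.exact_iff]
  change Function.Exact (F.linPart.d (i + 2) (i + 1)).hom (F.linPart.d (i + 1) i).hom ↔ _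
  rw [hd, hd]
  exact exact_lmap_iff _ _

lemma exact_grD_iff (n i : ℕ) :
    Function.Exact (F.grD n (i + 1)) (F.grD n i) ↔
      ∀ x ∈ F.filt n (i + 1), F.d i x ∈ F.filt (n + 1) i →
        ∃ y ∈ F.filt n (i + 2), x - F.d (i + 1) y ∈ F.filt (n + 1) (i + 1) := by
  constructor
  · intro h x hx hdx
    obtain ⟨y, hy⟩ := (h (Submodule.Quotient.mk ⟨x, hx⟩)).mp
      ((Submodule.Quotient.mk_eq_zero ((F.filt (n + 1) i).submoduleOf _)).mpr hdx)
    obtain ⟨⟨y, hy'⟩, rfl⟩ := Submodule.Quotient.mk_surjective _ y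
    exact ⟨y, hy', (Submodule.Quotient.eq ((F.filt (n + 1) (i + 1)).submoduleOf _)).mp hy.symm⟩
  · refine fun h => LinearMap.exact_of_comp_eq_zero_of_ker_le_range (F.grD_comp_grD n i) ?_
    intro x hx
    obtain ⟨⟨x, hx'⟩, rfl⟩ := Submodule.Quotient.mk_surjective _ x
    obtain ⟨y, hy, hxy⟩ := h x hx'
      ((Submodule.Quotient.mk_eq_zero ((F.filt (n + 1) i).submoduleOf _)).mp hx)
    exact ⟨Submodule.Quotient.mk ⟨y, hy⟩,
      ((Submodule.Quotient.eq ((F.filt (n + 1) (i + 1)).submoduleOf _)).mpr hxy).symm⟩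

lemma isShiftStrict_d_iff (i : ℕ) :
    IsShiftStrict 𝔪 (F.d i) ↔
      ∀ n x, F.d i x ∈ F.filt n i → ∃ x' ∈ F.filt n (i + 1), F.d i x' = F.d i x := by
  have filt_add (k : ℕ) : F.filt (i + 1 + k) i = 𝔪 ^ (k + 1) • ⊤ := by
    rw [filt, add_assoc, Nat.add_sub_cancel_left, add_comm]
  have filt_add_succ (k : ℕ) : F.filt (i + 1 + k) (i + 1) = 𝔪 ^ k • ⊤ := by
    rw [filt, Nat.add_sub_cancel_left]
  constructor
  · intro h n x hx
    rcases le_or_gt n i with hni | hin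
    · exact ⟨x, F.filt_of_le (hni.trans i.le_succ) ▸ Submodule.mem_top, rfl⟩
    · obtain ⟨k, rfl⟩ := Nat.exists_eq_add_of_le hin
      rw [filt_add_succ]
      exact h k x (filt_add k ▸ hx)
  · intro h k x hx
    rw [← filt_add_succ]
    exact h (i + 1 + k) x ((filt_add k).symm ▸ hx)

lemma isShiftStrict_d_of_exact_grD {i : ℕ}
    (h : ∀ n, Function.Exact (F.grD n (i + 1)) (F.grD n i)) : IsShiftStrict 𝔪 (F.d i) := by
  refine (F.isShiftStrict_d_iff i).mpr fun n x => ?_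
  induction n with
  | zero => exact fun _ => ⟨x, F.filt_of_le (Nat.zero_le _) ▸ Submodule.mem_top, rfl⟩
  | succ n ih =>
    intro hx
    obtain ⟨x', hx', hdx'⟩ := ih (F.filt_succ_le n i hx)
    obtain ⟨y, -, hy⟩ := (F.exact_grD_iff n i).mp (h n) x' hx' (hdx' ▸ hx)
    exact ⟨_, hy, by rw [map_sub, (F.isResolution.exact_succ i).apply_apply_eq_zero, sub_zero,
      hdx']⟩

lemma exact_grD_of_isShiftStrict_d {i : ℕ} (h₀ : IsShiftStrict 𝔪 (F.d i))
    (h₁ : IsShiftStrict 𝔪 (F.d (i + 1))) (n : ℕ) :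
    Function.Exact (F.grD n (i + 1)) (F.grD n i) := by
  refine (F.exact_grD_iff n i).mpr fun x hx hdx => ?_
  obtain ⟨x', hx', hdx'⟩ := (F.isShiftStrict_d_iff i).mp h₀ _ _ hdx
  obtain ⟨y, hy⟩ := (F.isResolution.exact_succ i (x - x')).mp (by rw [map_sub, hdx', sub_self])
  obtain ⟨y', hy', hdy'⟩ := (F.isShiftStrict_d_iff (i + 1)).mp h₁ n y
    (hy ▸ Submodule.sub_mem _ hx (F.filt_succ_le _ _ hx'))
  exact ⟨y', hy', by rwa [hdy', hy, sub_sub_cancel]⟩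

lemma linDefect_le_iff (e : ℕ∞) :
    F.linDefect ≤ e ↔ ∀ i : ℕ, e ≤ i → IsShiftStrict 𝔪 (F.d i) := by
  constructor
  · intro h i hi
    refine F.isShiftStrict_d_of_exact_grD ((F.isZero_homology_linPart_iff i).mp ?_)
    by_contra hne
    have hle : ((i + 1 : ℕ) : ℕ∞) ≤ F.linDefect := le_sSup ⟨i + 1, rfl, hne⟩
    exact i.not_succ_le_self (ENat.natCast_le_natCast.mp (hle.trans (h.trans hi)))
  · intro h
    refine sSup_le ?_
    rintro _ ⟨_ | i, rfl, hne⟩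
    · exact zero_le
    · by_contra hlt
      have hi : e ≤ i := Order.le_of_lt_add_one (by simpa using hlt)
      exact hne ((F.isZero_homology_linPart_iff i).mpr (F.exact_grD_of_isShiftStrict_d (h i hi)
        (h (i + 1) (hi.trans (by simp)))))

lemma linDefect_eq_zero_iff : F.linDefect = 0 ↔ ∀ i, IsShiftStrict 𝔪 (F.d i) := by
  rw [← nonpos_iff_eq_zero, linDefect_le_iff]
  simp only [zero_le, forall_const]

end MinimalFreeResolution

section Gluing

variable {R : Type*} [CommRing R] {I : Ideal R} {M P N : Type*} [AddCommGroup M] [Module R M]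
  [AddCommGroup P] [Module R P] [AddCommGroup N] [Module R N]
  {X Y : ℕ → Type*} [∀ i, AddCommGroup (X i)] [∀ i, Module R (X i)]
  [∀ i, AddCommGroup (Y i)] [∀ i, Module R (Y i)]

/-- The data of the horseshoe lemma for a short exact sequence `0 → M → P → N → 0` and resolutions
`X → M` and `Y → N`: a lift `Y 0 → P` of the augmentation of `Y` and the off-diagonal components
`Y (i + 1) → X i` of the differential on `X ⊕ Y`. The signs make that a complex over `P`. -/
structure Horseshoe (dX : ∀ i, X (i + 1) →ₗ[R] X i) (εX : X 0 →ₗ[R] M)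
    (dY : ∀ i, Y (i + 1) →ₗ[R] Y i) (εY : Y 0 →ₗ[R] N) (φ : M →ₗ[R] P) (ψ : P →ₗ[R] N) where
  lift : Y 0 →ₗ[R] P
  twist : ∀ i, Y (i + 1) →ₗ[R] X i
  map_lift : ∀ y, ψ (lift y) = εY y
  map_aug_twist : ∀ y, φ (εX (twist 0 y)) = -lift (dY 0 y)
  d_twist : ∀ i y, dX i (twist (i + 1) y) = -twist i (dY (i + 1) y)

namespace Horseshoe

variable {dX : ∀ i, X (i + 1) →ₗ[R] X i} {εX : X 0 →ₗ[R] M} {dY : ∀ i, Y (i + 1) →ₗ[R] Y i}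
  {εY : Y 0 →ₗ[R] N} {φ : M →ₗ[R] P} {ψ : P →ₗ[R] N}

lemma nonempty [∀ i, Module.Projective R (Y i)] (hX : IsResolution dX εX)
    (hY : IsResolution dY εY) (hφ : Function.Injective φ) (hφψ : Function.Exact φ ψ)
    (hψ : Function.Surjective ψ) : Nonempty (Horseshoe dX εX dY εY φ ψ) := by
  obtain ⟨lift, hlift⟩ := Module.projective_lifting_property ψ εY hψ
  have map_lift (y) : ψ (lift y) = εY y := LinearMap.congr_fun hlift y
  obtain ⟨m, hm⟩ := exists_comp_eq_of_exact hφψ (-lift ∘ₗ dY 0) fun y => by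
    simp [map_lift, hY.exact_zero.apply_apply_eq_zero]
  obtain ⟨τ₀, hτ₀⟩ := Module.projective_lifting_property εX m hX.surjective
  have map_aug_twist (y) : φ (εX (τ₀ y)) = -lift (dY 0 y) := by
    have hεX : εX (τ₀ y) = m y := LinearMap.congr_fun hτ₀ y
    rw [hεX, hm]
    rfl
  have twist_mem (y) : τ₀ (dY 1 y) ∈ Set.range (dX 0) := by
    rw [← hX.exact_zero]
    apply hφ
    rw [map_aug_twist, (hY.exact_succ 0).apply_apply_eq_zero, map_zero, neg_zero, map_zero]
  have step (i) (τ : {τ : Y (i + 1) →ₗ[R] X i // ∀ y, τ (dY (i + 1) y) ∈ Set.range (dX i)}) :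
      ∃ τ' : {τ : Y (i + 2) →ₗ[R] X (i + 1) // ∀ y, τ (dY (i + 2) y) ∈ Set.range (dX (i + 1))},
        ∀ y, dX i (τ'.1 y) = -τ.1 (dY (i + 1) y) := by
    obtain ⟨τ', hτ'⟩ := exists_comp_eq_of_range_le (-τ.1 ∘ₗ dY (i + 1)) (dX i) (by
      rintro _ ⟨y, rfl⟩
      exact Submodule.neg_mem _ (τ.2 y))
    refine ⟨⟨τ', fun y => ?_⟩, LinearMap.congr_fun hτ'⟩
    rw [← hX.exact_succ, ← LinearMap.comp_apply, hτ']
    simp [(hY.exact_succ (i + 1)).apply_apply_eq_zero]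
  choose succTwist hsuccTwist using step
  exact ⟨⟨lift, fun i => (Nat.rec ⟨τ₀, twist_mem⟩ succTwist i :
    {τ : Y (i + 1) →ₗ[R] X i // ∀ y, τ (dY (i + 1) y) ∈ Set.range (dX i)}).1, map_lift,
    map_aug_twist, fun i => hsuccTwist i _⟩⟩

variable (D : Horseshoe dX εX dY εY φ ψ)

/-- The differential of the glued resolution of `P`. -/
def d (i : ℕ) : X (i + 1) × Y (i + 1) →ₗ[R] X i × Y i :=
  ((dX i).coprod (D.twist i)).prod (dY i ∘ₗ LinearMap.snd R _ _)

/-- The augmentation of the glued resolution of `P`. -/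
def aug : X 0 × Y 0 →ₗ[R] P :=
  (φ ∘ₗ εX).coprod D.lift

lemma d_apply (i : ℕ) (u : X (i + 1)) (v : Y (i + 1)) :
    D.d i (u, v) = (dX i u + D.twist i v, dY i v) := rfl

lemma aug_apply (u : X 0) (v : Y 0) : D.aug (u, v) = φ (εX u) + D.lift v := rfl

lemma aug_surjective (hX : Function.Surjective εX) (hY : Function.Surjective εY)
    (hφψ : Function.Exact φ ψ) : Function.Surjective D.aug := by
  intro p
  obtain ⟨v, hv⟩ := hY (ψ p)
  obtain ⟨m, hm⟩ := (hφψ (p - D.lift v)).mp (by rw [map_sub, D.map_lift, hv, sub_self])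
  obtain ⟨u, rfl⟩ := hX m
  exact ⟨(u, v), by rw [aug_apply, hm, sub_add_cancel]⟩

lemma exact_d_aug (hX : Function.Exact (dX 0) εX) (hY : Function.Exact (dY 0) εY)
    (hφ : Function.Injective φ) (hφψ : Function.Exact φ ψ) :
    Function.Exact (D.d 0) D.aug := by
  rintro ⟨p, q⟩
  rw [aug_apply]
  constructor
  · intro h
    obtain ⟨v, rfl⟩ := (hY q).mp (by
      simpa [hφψ.apply_apply_eq_zero, D.map_lift] using congrArg ψ h)
    rw [← neg_neg (D.lift _), ← D.map_aug_twist, ← sub_eq_add_neg, ← map_sub, ← map_sub] at h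
    obtain ⟨u, hu⟩ := (hX _).mp (hφ (h.trans (map_zero φ).symm))
    exact ⟨(u, v), by rw [d_apply, hu, sub_add_cancel]⟩
  · rintro ⟨⟨u, v⟩, huv⟩
    obtain ⟨rfl, rfl⟩ := Prod.ext_iff.mp huv
    simp [d_apply, hX.apply_apply_eq_zero, D.map_aug_twist]

lemma exact_d_d (i : ℕ) (hX : Function.Exact (dX (i + 1)) (dX i))
    (hY : Function.Exact (dY (i + 1)) (dY i)) : Function.Exact (D.d (i + 1)) (D.d i) := by
  rintro ⟨p, q⟩
  rw [d_apply, Prod.mk_eq_zero]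
  constructor
  · rintro ⟨hp, hq⟩
    obtain ⟨v, rfl⟩ := (hY q).mp hq
    rw [← neg_neg (D.twist i _), ← D.d_twist, ← sub_eq_add_neg, ← map_sub] at hp
    obtain ⟨u, hu⟩ := (hX _).mp hp
    exact ⟨(u, v), by rw [d_apply, hu, sub_add_cancel]⟩
  · rintro ⟨⟨u, v⟩, huv⟩
    obtain ⟨rfl, rfl⟩ := Prod.ext_iff.mp huv
    simp [d_apply, hX.apply_apply_eq_zero, hY.apply_apply_eq_zero, D.d_twist]

lemma isResolution (hX : IsResolution dX εX) (hY : IsResolution dY εY)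
    (hφ : Function.Injective φ) (hφψ : Function.Exact φ ψ) :
    IsResolution (X := fun i => X i × Y i) D.d D.aug where
  surjective := D.aug_surjective hX.surjective hY.surjective hφψ
  exact_zero := D.exact_d_aug hX.exact_zero hY.exact_zero hφ hφψ
  exact_succ i := D.exact_d_d i (hX.exact_succ i) (hY.exact_succ i)

lemma range_twist_zero_le (hX : IsResolution dX εX)
    (hdX : LinearMap.range (dX 0) ≤ I • (⊤ : Submodule R (X 0)))
    (hdY : LinearMap.range (dY 0) ≤ I • (⊤ : Submodule R (Y 0)))
    (hφI : (I • (⊤ : Submodule R P)).comap φ ≤ I • ⊤) :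
    LinearMap.range (D.twist 0) ≤ I • (⊤ : Submodule R (X 0)) := by
  rintro _ ⟨y, rfl⟩
  have hlift : D.lift (dY 0 y) ∈ I • (⊤ : Submodule R P) :=
    Submodule.smul_top_le_comap_smul_top I D.lift (hdY ⟨y, rfl⟩)
  have haug : εX (D.twist 0 y) ∈ I • (⊤ : Submodule R M) := by
    apply hφI
    rw [Submodule.mem_comap, D.map_aug_twist]
    exact Submodule.neg_mem _ hlift
  obtain ⟨z, hz, hzy⟩ := exists_mem_smul_top_of_surjective hX.surjective haug
  obtain ⟨u, hu⟩ := (hX.exact_zero (D.twist 0 y - z)).mp (by rw [map_sub, hzy, sub_self])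
  rw [← sub_add_cancel (D.twist 0 y) z, ← hu]
  exact Submodule.add_mem _ (hdX ⟨u, rfl⟩) hz

lemma range_twist_le (hX : IsResolution dX εX) (hXs : ∀ i, IsShiftStrict I (dX i))
    (hdX : ∀ i, LinearMap.range (dX i) ≤ I • (⊤ : Submodule R (X i)))
    (hdY : ∀ i, LinearMap.range (dY i) ≤ I • (⊤ : Submodule R (Y i)))
    (hφI : (I • (⊤ : Submodule R P)).comap φ ≤ I • ⊤) (i : ℕ) :
    LinearMap.range (D.twist i) ≤ I • (⊤ : Submodule R (X i)) := by
  induction i with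
  | zero => exact D.range_twist_zero_le hX (hdX 0) (hdY 0) hφI
  | succ i ih =>
    rintro _ ⟨y, rfl⟩
    have hd : dX i (D.twist (i + 1) y) ∈ I ^ 2 • (⊤ : Submodule R (X i)) := by
      rw [D.d_twist]
      exact Submodule.neg_mem _
        (map_mem_pow_succ_smul_top ih (by simpa using hdY (i + 1) ⟨y, rfl⟩))
    obtain ⟨z, hz, hzy⟩ := hXs i 1 _ hd
    obtain ⟨u, hu⟩ := (hX.exact_succ i (D.twist (i + 1) y - z)).mp
      (by rw [map_sub, hzy, sub_self])
    rw [← sub_add_cancel (D.twist (i + 1) y) z, ← hu]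
    exact Submodule.add_mem _ (hdX (i + 1) ⟨u, rfl⟩) (by simpa using hz)

lemma isShiftStrict_d {i : ℕ} (hY : Function.Exact (dY (i + 1)) (dY i))
    (hτ : LinearMap.range (D.twist i) ≤ I • (⊤ : Submodule R (X i)))
    (hXs : IsShiftStrict I (dX i)) (hYs : IsShiftStrict I (dY i)) : IsShiftStrict I (D.d i) := by
  rintro n ⟨u, v⟩ huv
  have hfst : dX i u + D.twist i v ∈ I ^ (n + 1) • (⊤ : Submodule R (X i)) :=
    Submodule.smul_top_le_comap_smul_top _ (LinearMap.fst R _ _) huv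
  have hsnd : dY i v ∈ I ^ (n + 1) • (⊤ : Submodule R (Y i)) :=
    Submodule.smul_top_le_comap_smul_top _ (LinearMap.snd R _ _) huv
  obtain ⟨v', hv', hdv'⟩ := hYs n v hsnd
  obtain ⟨z, hz⟩ := (hY (v - v')).mp (by rw [map_sub, hdv', sub_self])
  have hu : dX i (u - D.twist (i + 1) z) = dX i u + D.twist i v - D.twist i v' := by
    rw [map_sub, D.d_twist, hz, map_sub]
    abel
  obtain ⟨u', hu', hdu'⟩ := hXs n _
    (hu ▸ Submodule.sub_mem _ hfst (map_mem_pow_succ_smul_top hτ hv'))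
  exact ⟨(u', v'), prodMk_mem_smul_top hu' hv', by
    rw [d_apply, d_apply, hdu', hu, hdv', sub_add_cancel]⟩

lemma exists_mem_of_isShiftStrict_d {i n : ℕ} (hD : IsShiftStrict I (D.d i)) {v : Y (i + 1)}
    (hv : dY i v ∈ I ^ (n + 1) • (⊤ : Submodule R (Y i))) {p : X i}
    (hp : p ∈ I ^ (n + 1) • (⊤ : Submodule R (X i)))
    (hpv : p - D.twist i v ∈ Set.range (dX i)) :
    ∃ v' ∈ I ^ n • (⊤ : Submodule R (Y (i + 1))), dY i v' = dY i v := by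
  obtain ⟨u, hu⟩ := hpv
  have hd : D.d i (u, v) = (p, dY i v) := by rw [d_apply, hu, sub_add_cancel]
  obtain ⟨w, hw, hdw⟩ := hD n (u, v) (hd ▸ prodMk_mem_smul_top hp hv)
  exact ⟨w.2, Submodule.smul_top_le_comap_smul_top _ (LinearMap.snd R _ _) hw,
    congrArg Prod.snd (hdw.trans hd)⟩

lemma isShiftStrict_right_succ {i : ℕ} (hX : Function.Exact (dX (i + 1)) (dX i))
    (hτ : LinearMap.range (D.twist i) ≤ I • (⊤ : Submodule R (X i)))
    (hXs : IsShiftStrict I (dX i)) (hD : IsShiftStrict I (D.d (i + 1))) :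
    IsShiftStrict I (dY (i + 1)) := by
  intro n v hv
  have hd : dX i (D.twist (i + 1) v) ∈ I ^ (n + 1 + 1) • (⊤ : Submodule R (X i)) := by
    rw [D.d_twist]
    exact Submodule.neg_mem _ (map_mem_pow_succ_smul_top hτ hv)
  obtain ⟨p, hp, hdp⟩ := hXs (n + 1) _ hd
  exact D.exists_mem_of_isShiftStrict_d hD hv hp
    ((hX _).mp (by rw [map_sub, hdp, sub_self]))

lemma isShiftStrict_right_zero (hX : IsResolution dX εX) (hD : IsShiftStrict I (D.d 0))
    (hφI : ∀ s, 1 ≤ s → (I ^ s • (⊤ : Submodule R P)).comap φ ≤ I ^ s • ⊤) :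
    IsShiftStrict I (dY 0) := by
  intro n v hv
  have haug : εX (D.twist 0 v) ∈ I ^ (n + 1) • (⊤ : Submodule R M) := by
    apply hφI (n + 1) n.succ_pos
    rw [Submodule.mem_comap, D.map_aug_twist]
    exact Submodule.neg_mem _ (Submodule.smul_top_le_comap_smul_top _ D.lift hv)
  obtain ⟨p, hp, hpv⟩ := exists_mem_smul_top_of_surjective hX.surjective haug
  exact D.exists_mem_of_isShiftStrict_d hD hv hp
    ((hX.exact_zero _).mp (by rw [map_sub, hpv, sub_self]))

lemma comap_pow_smul_top_le (hX : Function.Surjective εX) (hY : IsResolution dY εY)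
    (hφ : Function.Injective φ) (hφψ : Function.Exact φ ψ)
    (hτ : LinearMap.range (D.twist 0) ≤ I • (⊤ : Submodule R (X 0)))
    (hYs : IsShiftStrict I (dY 0)) (n : ℕ) :
    (I ^ (n + 1) • (⊤ : Submodule R P)).comap φ ≤ I ^ (n + 1) • ⊤ := by
  intro m hm
  obtain ⟨⟨p, q⟩, hpq, hm⟩ :=
    exists_mem_smul_top_of_surjective (D.aug_surjective hX hY.surjective hφψ) hm
  have hp : p ∈ I ^ (n + 1) • (⊤ : Submodule R (X 0)) :=
    Submodule.smul_top_le_comap_smul_top _ (LinearMap.fst R _ _) hpq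
  have hq : q ∈ I ^ (n + 1) • (⊤ : Submodule R (Y 0)) :=
    Submodule.smul_top_le_comap_smul_top _ (LinearMap.snd R _ _) hpq
  rw [aug_apply] at hm
  obtain ⟨v, rfl⟩ := (hY.exact_zero q).mp (by
    simpa [hφψ.apply_apply_eq_zero, D.map_lift] using congrArg ψ hm)
  obtain ⟨v', hv', hdv'⟩ := hYs n v hq
  have hm' : εX (p - D.twist 0 v') = m := by
    apply hφ
    rw [map_sub, map_sub, D.map_aug_twist, hdv', sub_neg_eq_add, hm]
  rw [← hm']
  exact Submodule.smul_top_le_comap_smul_top _ εX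
    (Submodule.sub_mem _ hp (map_mem_pow_succ_smul_top hτ hv'))

end Horseshoe

end Gluing

theorem theorem3p1_general {R : Type u} [CommRing R] {𝔪 : Ideal R} {M P N : Type*}
    [AddCommGroup M] [Module R M] [AddCommGroup P] [Module R P] [AddCommGroup N] [Module R N]
    (F : MinimalFreeResolution 𝔪 M) (G : MinimalFreeResolution 𝔪 P)
    (L : MinimalFreeResolution 𝔪 N) {φ : M →ₗ[R] P} {ψ : P →ₗ[R] N}
    (hφ : Function.Injective φ) (hφψ : Function.Exact φ ψ) (hψ : Function.Surjective ψ)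
    (hF : F.linDefect = 0)
    (hM : LinearMap.range φ ⊓ 𝔪 • (⊤ : Submodule R P) = (𝔪 • (⊤ : Submodule R M)).map φ) :
    (G.linDefect ≤ L.linDefect ∧ L.linDefect ≤ max G.linDefect 1) ∧
    (1 ≤ G.linDefect → L.linDefect = G.linDefect) ∧
    (G.linDefect = 0 → L.linDefect ≤ 1) ∧
    (L.linDefect = 0 ↔ G.linDefect = 0 ∧ ∀ s : ℕ, 1 ≤ s →
      LinearMap.range φ ⊓ 𝔪 ^ s • (⊤ : Submodule R P) =
        (𝔪 ^ s • (⊤ : Submodule R M)).map φ) := by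
  simp only [range_inf_smul_top_eq_map_iff hφ, F.linDefect_eq_zero_iff] at hF hM ⊢
  obtain ⟨D⟩ := Horseshoe.nonempty F.isResolution L.isResolution hφ hφψ hψ
  have hτ := D.range_twist_le F.isResolution hF F.minimal L.minimal hM
  have hG (i) : IsShiftStrict 𝔪 (G.d i) ↔ IsShiftStrict 𝔪 (D.d i) :=
    G.isResolution.isShiftStrict_iff (D.isResolution F.isResolution L.isResolution hφ hφψ) i
  have of_right {i} (h : IsShiftStrict 𝔪 (L.d i)) : IsShiftStrict 𝔪 (G.d i) :=
    (hG i).mpr (D.isShiftStrict_d (L.isResolution.exact_succ i) (hτ i) (hF i) h)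
  have right_succ {i} (h : IsShiftStrict 𝔪 (G.d (i + 1))) : IsShiftStrict 𝔪 (L.d (i + 1)) :=
    D.isShiftStrict_right_succ (F.isResolution.exact_succ i) (hτ i) (hF i) ((hG _).mp h)
  have le_right : G.linDefect ≤ L.linDefect :=
    (G.linDefect_le_iff _).mpr fun i hi => of_right ((L.linDefect_le_iff _).mp le_rfl i hi)
  have right_le : L.linDefect ≤ max G.linDefect 1 := by
    rw [L.linDefect_le_iff]
    rintro (_ | i) hi
    · simp at hi
    · exact right_succ ((G.linDefect_le_iff _).mp le_rfl _ ((le_max_left _ _).trans hi))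
  refine ⟨⟨le_right, right_le⟩, fun h => le_antisymm (by rwa [max_eq_left h] at right_le) le_right,
    fun h => by simpa [h] using right_le, ?_⟩
  rw [L.linDefect_eq_zero_iff, G.linDefect_eq_zero_iff]
  constructor
  · refine fun h => ⟨fun i => of_right (h i), fun s hs => ?_⟩
    obtain ⟨n, rfl⟩ := Nat.exists_eq_add_of_le' hs
    exact D.comap_pow_smul_top_le F.aug_surjective L.isResolution hφ hφψ (hτ 0) (h 0) n
  · rintro ⟨h, hs⟩ (_ | i)
    · exact D.isShiftStrict_right_zero F.isResolution ((hG 0).mp (h 0)) hs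
    · exact right_succ (h (i + 1))

theorem theorem3p1 :
    -- the local case
    (∀ (R : Type u) [CommRing R] [IsLocalRing R] [IsNoetherianRing R]
      (M P N : Type v)
      [AddCommGroup M] [Module R M] [Module.Finite R M] [Nontrivial M]
      [AddCommGroup P] [Module R P] [Module.Finite R P] [Nontrivial P]
      [AddCommGroup N] [Module R N] [Module.Finite R N] [Nontrivial N]
      (φ : M →ₗ[R] P) (ψ : P →ₗ[R] N),
      Function.Injective φ → Function.Exact φ ψ → Function.Surjective ψ →
      IsKoszulModule R M →
      LinearMap.range φ ⊓ IsLocalRing.maximalIdeal R • (⊤ : Submodule R P) =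
        (IsLocalRing.maximalIdeal R • (⊤ : Submodule R M)).map φ →
      (lind R P ≤ lind R N ∧ lind R N ≤ max (lind R P) 1) ∧
      (1 ≤ lind R P → lind R N = lind R P) ∧
      (lind R P = 0 → lind R N ≤ 1) ∧
      (lind R N = 0 ↔ IsKoszulModule R P ∧ ∀ s : ℕ, 1 ≤ s →
        LinearMap.range φ ⊓ IsLocalRing.maximalIdeal R ^ s • (⊤ : Submodule R P) =
          (IsLocalRing.maximalIdeal R ^ s • (⊤ : Submodule R M)).map φ)) ∧
    -- the graded case
    (∀ (k : Type w) (R : Type u) [Field k] [CommRing R] [Algebra k R]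
      (𝒜 : ℕ → Submodule k R) [GradedAlgebra 𝒜] [IsStandardGraded 𝒜]
      (M P N : Type v)
      [AddCommGroup M] [Module R M] [Module.Finite R M] [Nontrivial M]
      [AddCommGroup P] [Module R P] [Module.Finite R P] [Nontrivial P]
      [AddCommGroup N] [Module R N] [Module.Finite R N] [Nontrivial N]
      (grM : ℤ → AddSubgroup M) [IsGradedModule 𝒜 grM]
      (grP : ℤ → AddSubgroup P) [IsGradedModule 𝒜 grP]
      (grN : ℤ → AddSubgroup N) [IsGradedModule 𝒜 grN]
      (φ : M →ₗ[R] P) (ψ : P →ₗ[R] N),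
      (∀ d, ∀ m ∈ grM d, φ m ∈ grP d) → (∀ d, ∀ p ∈ grP d, ψ p ∈ grN d) →
      Function.Injective φ → Function.Exact φ ψ → Function.Surjective ψ →
      IsGradedKoszulModule 𝒜 grM →
      LinearMap.range φ ⊓ gradedMaximalIdeal 𝒜 • (⊤ : Submodule R P) =
        (gradedMaximalIdeal 𝒜 • (⊤ : Submodule R M)).map φ →
      (gradedLind 𝒜 grP ≤ gradedLind 𝒜 grN ∧ gradedLind 𝒜 grN ≤ max (gradedLind 𝒜 grP) 1) ∧
      (1 ≤ gradedLind 𝒜 grP → gradedLind 𝒜 grN = gradedLind 𝒜 grP) ∧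
      (gradedLind 𝒜 grP = 0 → gradedLind 𝒜 grN ≤ 1) ∧
      (gradedLind 𝒜 grN = 0 ↔ IsGradedKoszulModule 𝒜 grP ∧ ∀ s : ℕ, 1 ≤ s →
        LinearMap.range φ ⊓ gradedMaximalIdeal 𝒜 ^ s • (⊤ : Submodule R P) =
          (gradedMaximalIdeal 𝒜 ^ s • (⊤ : Submodule R M)).map φ)) := by
  refine ⟨?_, ?_⟩
  · intro R _ _ _ M P N _ _ _ _ _ _ _ _ _ _ _ _ φ ψ hφ hφψ hψ hM hMP
    exact theorem3p1_general _ _ _ hφ hφψ hψ hM hMP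
  · intro k R _ _ _ 𝒜 _ _ M P N _ _ _ _ _ _ _ _ _ _ _ _ grM _ grP _ grN _ φ ψ _ _ hφ hφψ hψ hM hMP
    exact theorem3p1_general _ _ _ hφ hφψ hψ hM hMP
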